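/- For integers $W,L,d,d'\ge 1$ let $\Upsilon^{W,L}(\mathrm{ReLU};d,d')$ denote the set of all output functions $\mathbb{R}^d\to\mathbb{R}^{d'}$ of fully connected feed-forward neural networks with $L$ hidden layers, each of width $W$, with activation $\mathrm{ReLU}(t)=\max\{0,t\}$ (applied coordinatewise) at every hidden node and an affine output layer; the weights and biases are arbitrary real numbers. **(Bit extraction.)** Let $N=n^2$ with $n\ge 4$ an even integer, and let $t_i=i/N$, $i=0,1,\dots,N$. Let $y_0,\dots,y_N\in\mathbb{R}$ be any data such that (i) $y_{jn}=0$ for $j=0,\dots,n$, and (ii) $y_{i+1}-y_i\in\{-1,1\}$ for $i=0,\dots,N-1$. Then there is $S\in\Upsilon^{11,15n+2}(\mathrm{ReLU};1,1)$ such that $$S(t_i)=y_i,\qquad i=0,\dots,N,$$ and $$|S(t)-S(t_i)|\le 1,\qquad t\in[t_i,t_{i+1}],\quad i=0,\dots,N-1.$$ **(VC dimension.)** For a set $\mathcal F$ of real-valued functions, a set of $m$ distinct points $x^{(1)},\dots,x^{(m)}\in[0,1]^d$ is shattered by $\mathcal F$ if for every $\Lambda\subset\{1,\dots,m\}$ there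 is $f\in\mathcal F$ such that $f(x^{(i)})>0$ if and only if $i\in\Lambda$, and $\mathrm{VC}(\mathcal F)$ is the supremum of all $m$ for which some set of $m$ points of $[0,1]^d$ is shattered by $\mathcal F$. There is an absolute constant $c>0$ such that $$\mathrm{VC}(\Upsilon^{W,L}(\mathrm{ReLU};1,1))\ge c\,L^2\qquad\text{for all } W\ge 11,\ L\ge 1.$$ More generally, for every $d\ge 1$ there are $W_0\in\mathbb{N}$ and $c>0$, depending only on $d$, such that $$\mathrm{VC}(\Upsilon^{W,L}(\mathrm{ReLU};d,1))\ge c\,L^2\qquad\text{for all } W\ge W_0,\ L\ge 1.$$ -/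

import Mathlib

open scoped ENNReal

/-- The rectified linear unit `t ↦ max {0, t}`. -/
noncomputable def ReLU (t : ℝ) : ℝ := max 0 t

/-- The trainable parameters (weight matrices and bias vectors) of a fully connected feed-forward
network with input dimension `d`, output dimension `d'`, and `L` hidden layers, each of width `W`.
The constructor `layer` puts a hidden layer in front of the network `rest`, so that the
parameters are listed from the input to the output. -/
inductive FCNet (W d' : ℕ) : ℕ → ℕ → Type
  | output {d : ℕ} (A : Matrix (Fin d') (Fin d) ℝ) (b : Fin d' → ℝ) : FCNet W d' 0 d
  | layer {L d : ℕ} (A : Matrix (Fin W) (Fin d) ℝ) (b : Fin W → ℝ) (rest : FCNet W d' L W) :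
      FCNet W d' (L + 1) d

/-- The output function of a network with activation `σ`: each hidden layer maps `x` to
`σ (A x + b)`, with `σ` acting coordinatewise, and the output layer is affine (no activation). -/
def FCNet.eval {W d' : ℕ} (σ : ℝ → ℝ) :
    {L d : ℕ} → FCNet W d' L d → (Fin d → ℝ) → (Fin d' → ℝ)
  | _, _, .output A b, x => A.mulVec x + b
  | _, _, .layer A b rest, x => rest.eval σ (fun i => σ ((A.mulVec x + b) i))

/-- The set `Υ^{W,L}(σ; d, d')` of all output functions of fully connected networks of width `W`
and depth `L` (that is, `L` hidden layers), with activation `σ`, input dimension `d` and output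
dimension `d'`. -/
def Upsilon (W L : ℕ) (σ : ℝ → ℝ) (d d' : ℕ) : Set ((Fin d → ℝ) → (Fin d' → ℝ)) :=
  Set.range (fun N : FCNet W d' L d => N.eval σ)

/-- The outputs in `Υ^{W,L}(σ; d, 1)` read as real-valued functions. -/
def scalarUpsilon (W L : ℕ) (σ : ℝ → ℝ) (d : ℕ) : Set ((Fin d → ℝ) → ℝ) :=
  (fun S x => S x 0) '' Upsilon W L σ d 1

/-- A finite set `P` of points is shattered by `F` if for each subset `Λ` of `P` some `f ∈ F` is
positive at a point of `P` exactly when that point belongs to `Λ`. -/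
def ShatteredBy {X : Type*} (F : Set (X → ℝ)) (P : Finset X) : Prop :=
  ∀ Λ ⊆ P, ∃ f ∈ F, ∀ x ∈ P, 0 < f x ↔ x ∈ Λ

/-- The Vapnik-Chervonenkis dimension on the domain `Ω`: the largest number of points of `Ω` that
form a set shattered by `F` (`⊤` if there is no bound). -/
noncomputable def vcDimension {X : Type*} (Ω : Set X) (F : Set (X → ℝ)) : ℕ∞ :=
  ⨆ (P : Finset X) (_ : (P : Set X) ⊆ Ω ∧ ShatteredBy F P), (P.card : ℕ∞)

/-!
Bit extraction. In the variable `T = n ^ 2 * t` the walk `y` splits into `n` blocks of length `n`, at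
whose ends it vanishes. The network has two phases, each with a number of layers proportional to
`n`, so that it recovers about `n ^ 2` bits from about `n` layers.

In the first phase (`computes_blockData`), sums of ramps compute step functions of `T`: the number
of blocks to the left of `T`, from which the position `u ∈ [0, n]` inside the block results, and a
code of the block, a number whose ternary digits in `{0, 1}` tell which of its `n` steps go up. In
the second phase (`computes_digits`), two layers per step split off the leading digit `b` of the
code and add the part of `[k, k + 1]` to the left of `u`, multiplied by `b`, to an accumulator; the
product with a bit is the single node `ReLU (ramp (u - k) + b - 1)`. Twice the accumulator minus `u`
is the piecewise linear interpolation of the walk (`walkInterpolant_eq_truncation`).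

Step functions being discontinuous, the code passes through meaningless values between two blocks.
Its jumps are confined to the last half unit of each block, and the result is truncated to
`[-h, h]`, where `h` vanishes there and is large enough elsewhere. As the walk is zero at the block
ends, the value `0` on these half units is within distance `1` of the value to be approximated
(`walkInterpolant_spec`).

For the VC dimension, the walks that vanish at all even indices have arbitrary signs at the odd ones,
so that `n ^ 2 / 2` points are shattered (`two_mul_sq_le_vcDimension`). In higher dimension the
network reads one coordinate only.

All functions involved are handled through `Computes W d L s`: the functions in `s` are affine
combinations of the values of the `L`-th hidden layer of one network.
-/

/-! ### Networks read from the front -/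

/-- `h x` is the vector of values of the last of `L` hidden layers at the input `x`, for some choice
of the weights in front of it. This is encoded by what such a vector is good for: every network
`rest` that reads it completes to a network with `L` further hidden layers. -/
def Reaches (W d L : ℕ) (h : (Fin d → ℝ) → Fin W → ℝ) : Prop :=
  ∀ (d' L' : ℕ) (rest : FCNet W d' L' W),
    (fun x => rest.eval ReLU (h x)) ∈ Upsilon W (L + L') ReLU d d'

theorem Reaches.first {W d : ℕ} (A : Matrix (Fin W) (Fin d) ℝ) (b : Fin W → ℝ) :
    Reaches W d 1 (fun x i => ReLU ((A.mulVec x + b) i)) := by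
  intro d' L' rest
  rw [add_comm]
  exact ⟨.layer A b rest, rfl⟩

theorem Reaches.layer {W d L : ℕ} {h : (Fin d → ℝ) → Fin W → ℝ} (hh : Reaches W d L h)
    (A : Matrix (Fin W) (Fin W) ℝ) (b : Fin W → ℝ) :
    Reaches W d (L + 1) (fun x i => ReLU ((A.mulVec (h x) + b) i)) := by
  intro d' L' rest
  rw [add_assoc, add_comm 1 L']
  exact hh d' (L' + 1) (.layer A b rest)

/-- The affine combinations (with arbitrary real coefficients) of the functions in `s`. -/
def affineCombos {X : Type*} (s : Set (X → ℝ)) : Submodule ℝ (X → ℝ) :=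
  Submodule.span ℝ (insert 1 s)

theorem affineCombos_one {X : Type*} (s : Set (X → ℝ)) : (1 : X → ℝ) ∈ affineCombos s :=
  Submodule.subset_span (Set.mem_insert _ _)

theorem mem_affineCombos {X : Type*} {s : Set (X → ℝ)} {f : X → ℝ} (hf : f ∈ s) :
    f ∈ affineCombos s :=
  Submodule.subset_span (Set.mem_insert_of_mem _ hf)

theorem affineCombos_le {X : Type*} {s : Set (X → ℝ)} {t : Set (X → ℝ)}
    (h : ∀ f ∈ s, f ∈ affineCombos t) : affineCombos s ≤ affineCombos t := by
  refine Submodule.span_le.2 ?_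
  rintro f (rfl | hf)
  · exact affineCombos_one t
  · exact h f hf

theorem exists_coeff_of_mem_affineCombos {X : Type*} {W : ℕ} {h : X → Fin W → ℝ} {f : X → ℝ}
    (hf : f ∈ affineCombos (Set.range fun i x => h x i)) :
    ∃ (c : Fin W → ℝ) (a : ℝ), ∀ x, f x = c ⬝ᵥ h x + a := by
  obtain ⟨a, z, hz, rfl⟩ := Submodule.mem_span_insert.1 hf
  obtain ⟨c, rfl⟩ := (Submodule.mem_span_range_iff_exists_fun ℝ).1 hz
  refine ⟨c, a, fun x => ?_⟩
  simp [dotProduct, Finset.sum_apply, add_comm]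

/-- The functions in `s` are simultaneously outputs of one network with `L` hidden layers of
width `W`, up to the choice of the affine output layer. -/
def Computes (W d L : ℕ) (s : Set ((Fin d → ℝ) → ℝ)) : Prop :=
  ∃ h, Reaches W d L h ∧ ∀ f ∈ s, f ∈ affineCombos (Set.range fun i x => h x i)

theorem Computes.mono {W d L : ℕ} {s t : Set ((Fin d → ℝ) → ℝ)} (hs : Computes W d L s)
    (hst : ∀ f ∈ t, f ∈ affineCombos s) : Computes W d L t := by
  obtain ⟨h, hh, hsh⟩ := hs
  exact ⟨h, hh, fun f hf => affineCombos_le hsh (hst f hf)⟩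

theorem Computes.layer {W d L m : ℕ} {s : Set ((Fin d → ℝ) → ℝ)} (hm : m ≤ W)
    (hs : Computes W d L s) (g : Fin m → (Fin d → ℝ) → ℝ) (hg : ∀ i, g i ∈ affineCombos s) :
    Computes W d (L + 1) (Set.range fun i x => ReLU (g i x)) := by
  obtain ⟨h, hh, hsh⟩ := hs
  -- the hidden nodes beyond the first `m` compute zero
  let g' : Fin W → (Fin d → ℝ) → ℝ := fun i => if hi : (i : ℕ) < m then g ⟨i, hi⟩ else 0
  have hg' : ∀ i, g' i ∈ affineCombos (Set.range fun i x => h x i) := by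
    intro i
    by_cases hi : (i : ℕ) < m
    · simpa [g', hi] using affineCombos_le hsh (hg ⟨i, hi⟩)
    · simp [g', hi]
  choose c a hca using fun i => exists_coeff_of_mem_affineCombos (hg' i)
  refine ⟨_, hh.layer (Matrix.of c) a, ?_⟩
  rintro _ ⟨i, rfl⟩
  refine mem_affineCombos ⟨⟨i, i.2.trans_le hm⟩, ?_⟩
  funext x
  have := hca ⟨i, i.2.trans_le hm⟩ x
  simp only [g', i.2, dif_pos] at this
  simp [this, Matrix.mulVec, Matrix.of_apply]

theorem node_mem {X : Type*} {m : ℕ} (g : Fin m → X → ℝ) (i : Fin m) :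
    (fun x => ReLU (g i x)) ∈ affineCombos (Set.range fun i x => ReLU (g i x)) :=
  mem_affineCombos ⟨i, rfl⟩

theorem computes_first {W d : ℕ} (hW : 1 ≤ W) (i₀ : Fin d) (a : ℝ) :
    Computes W d 1 {fun x => ReLU (a * x i₀)} := by
  refine ⟨_, Reaches.first (Matrix.of fun _ => Pi.single i₀ a) 0, ?_⟩
  rintro _ rfl
  refine mem_affineCombos ⟨⟨0, hW⟩, ?_⟩
  funext x
  simp [Matrix.mulVec]

theorem ReLU_nonneg (v : ℝ) : 0 ≤ ReLU v := le_max_left _ _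

theorem ReLU_of_nonneg {v : ℝ} (hv : 0 ≤ v) : ReLU v = v := max_eq_right hv

theorem ReLU_of_nonpos {v : ℝ} (hv : v ≤ 0) : ReLU v = 0 := max_eq_left hv

theorem ReLU_sub_ReLU_neg (v : ℝ) : ReLU v - ReLU (-v) = v := by
  rcases le_total 0 v with h | h
  · rw [ReLU_of_nonneg h, ReLU_of_nonpos (by linarith), sub_zero]
  · rw [ReLU_of_nonpos h, ReLU_of_nonneg (by linarith)]; ring

/-- A real-valued output can be carried through any number of further hidden layers. -/
theorem Computes.pad {W d L L' : ℕ} {f : (Fin d → ℝ) → ℝ} (hW : 2 ≤ W)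
    (hf : Computes W d L {f}) (hL : L ≤ L') : Computes W d L' {f} := by
  induction L', hL using Nat.le_induction with
  | base => exact hf
  | succ L' _ ih =>
    have hm : f ∈ affineCombos ({f} : Set ((Fin d → ℝ) → ℝ)) := mem_affineCombos rfl
    refine (ih.layer hW ![f, -f] ?_).mono ?_
    · intro i
      fin_cases i
      exacts [hm, neg_mem hm]
    · intro f' hf'
      rw [Set.mem_singleton_iff.1 hf']
      convert sub_mem (node_mem ![f, -f] 0) (node_mem ![f, -f] 1) using 1
      funext x
      simp [ReLU_sub_ReLU_neg]

theorem Computes.exists_mem_Upsilon {W d L : ℕ} {f : (Fin d → ℝ) → ℝ}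
    (hf : Computes W d L {f}) : ∃ S ∈ Upsilon W L ReLU d 1, ∀ x, S x 0 = f x := by
  obtain ⟨h, hh, hsh⟩ := hf
  obtain ⟨c, a, hca⟩ := exists_coeff_of_mem_affineCombos (hsh f rfl)
  refine ⟨_, hh 1 0 (.output (Matrix.of fun _ => c) fun _ => a), fun x => ?_⟩
  simp [FCNet.eval, hca, Matrix.mulVec]

/-! ### Ramps and the block data -/

/-- The continuous step from `0` (for `v ≤ 0`) to `1` (for `1 ≤ v`). -/
noncomputable def ramp (v : ℝ) : ℝ := ReLU v - ReLU (v - 1)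

theorem ramp_of_nonpos {v : ℝ} (hv : v ≤ 0) : ramp v = 0 := by
  rw [ramp, ReLU_of_nonpos hv, ReLU_of_nonpos (by linarith), sub_zero]

theorem ramp_of_one_le {v : ℝ} (hv : 1 ≤ v) : ramp v = 1 := by
  rw [ramp, ReLU_of_nonneg (by linarith), ReLU_of_nonneg (by linarith)]; ring

theorem ramp_of_mem {v : ℝ} (h0 : 0 ≤ v) (h1 : v ≤ 1) : ramp v = v := by
  rw [ramp, ReLU_of_nonneg h0, ReLU_of_nonpos (by linarith), sub_zero]

theorem ramp_nonneg (v : ℝ) : 0 ≤ ramp v :=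
  sub_nonneg.2 (max_le_max le_rfl (by linarith))

/-- The number of the first `J` blocks, of length `n`, that lie to the left of `T`; the jump to `m + 1` is spread
over the half unit that ends at `(m + 1) * n`. -/
noncomputable def blockCount (n J : ℕ) (T : ℝ) : ℝ :=
  ∑ m ∈ Finset.range J, ramp (2 * (T - (m + 1) * n) + 1)

/-- The value of `c` at the index of the block that contains `T`, with jumps spread as in
`blockCount`; `T` is taken to lie in the first `J + 1` blocks. -/
noncomputable def blockCode (n : ℕ) (c : ℕ → ℝ) (J : ℕ) (T : ℝ) : ℝ :=
  c 0 + ∑ m ∈ Finset.range J, (c (m + 1) - c m) * ramp (2 * (T - (m + 1) * n) + 1)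

/-- A trapezoid on each block: it rises from `0` to `1` over the first unit of the block, falls from
`1` to `0` over the first half of the last unit, and vanishes on the last half unit, where
`blockCount` and `blockCode` jump. -/
noncomputable def window (n J : ℕ) (T : ℝ) : ℝ :=
  ∑ m ∈ Finset.range J, (ramp (T - m * n) - ramp (2 * (T - (m + 1) * n + 1)))

/-- The remainder of the ternary code `c` after the extraction of `k` digits. -/
noncomputable def remainder (c : ℝ) : ℕ → ℝ
  | 0 => c
  | k + 1 => ReLU (3 * remainder c k - ramp (6 * remainder c k - 1))

/-- The sum over `k < K` of the `k`-th digit of `c` times the length of the part of `[k, k + 1]` to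
the left of `u`. The product is a single node because a digit in `{0, 1}` is either neutral or
switches the node off. -/
noncomputable def digitSum (c u : ℝ) (K : ℕ) : ℝ :=
  ∑ k ∈ Finset.range K, ReLU (ramp (u - k) + ramp (6 * remainder c k - 1) - 1)

/-- The position within the block that contains `T`. -/
noncomputable def blockPos (n : ℕ) (T : ℝ) : ℝ := ReLU (T - n * blockCount n n T)

/-- The function of `T = n ^ 2 * t` that the interpolating network computes: the walk with steps
`±1` read off the digits of the current code, truncated to `[-h, h]` for `h = n * window n n T`. -/
noncomputable def bitExtraction (n : ℕ) (c : ℕ → ℝ) (T : ℝ) : ℝ :=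
  let h := ReLU (n * window n n T)
  let s := 2 * digitSum (ReLU (blockCode n c n T)) (blockPos n T) n - blockPos n T
  ReLU (s + h) - ReLU (s - h) - h

/-! ### The network -/

section Network

variable {W d L : ℕ}

/-- One hidden layer adds multiples of a ramp to three accumulators. -/
theorem Computes.add_ramp (hW : 11 ≤ W) {τ f₁ f₂ f₃ : (Fin d → ℝ) → ℝ}
    (hs : Computes W d L {τ, f₁, f₂, f₃}) (hτ : ∀ x, 0 ≤ τ x) (p q a₁ a₂ a₃ : ℝ) :
    Computes W d (L + 1)
      {τ, fun x => f₁ x + a₁ * ramp (p * τ x + q), fun x => f₂ x + a₂ * ramp (p * τ x + q),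
        fun x => f₃ x + a₃ * ramp (p * τ x + q)} := by
  have h0 := mem_affineCombos (s := {τ, f₁, f₂, f₃}) (f := τ) (by simp)
  have h1 := mem_affineCombos (s := {τ, f₁, f₂, f₃}) (f := f₁) (by simp)
  have h2 := mem_affineCombos (s := {τ, f₁, f₂, f₃}) (f := f₂) (by simp)
  have h3 := mem_affineCombos (s := {τ, f₁, f₂, f₃}) (f := f₃) (by simp)
  have ho := affineCombos_one {τ, f₁, f₂, f₃}
  -- a signed function is carried by two nodes, its positive and its negative part
  let g : Fin 9 → (Fin d → ℝ) → ℝ :=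
    ![τ, f₁, -f₁, f₂, -f₂, f₃, -f₃, p • τ + q • 1, p • τ + (q - 1) • 1]
  refine (hs.layer (by omega) g ?_).mono ?_
  · intro i
    have hr (r : ℝ) : p • τ + r • 1 ∈ affineCombos {τ, f₁, f₂, f₃} :=
      add_mem (Submodule.smul_mem _ _ h0) (Submodule.smul_mem _ _ ho)
    fin_cases i
    exacts [h0, h1, neg_mem h1, h2, neg_mem h2, h3, neg_mem h3, hr q, hr (q - 1)]
  · have hr (a : ℝ) := Submodule.smul_mem _ a (sub_mem (node_mem g 7) (node_mem g 8))
    rintro _ (rfl | rfl | rfl | rfl)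
    · convert node_mem g 0 using 1
      funext x
      simp [g, ReLU_of_nonneg (hτ x)]
    · convert add_mem (sub_mem (node_mem g 1) (node_mem g 2)) (hr a₁) using 1
      funext x
      simp [g, ReLU_sub_ReLU_neg, ramp, add_sub_assoc]
    · convert add_mem (sub_mem (node_mem g 3) (node_mem g 4)) (hr a₂) using 1
      funext x
      simp [g, ReLU_sub_ReLU_neg, ramp, add_sub_assoc]
    · convert add_mem (sub_mem (node_mem g 5) (node_mem g 6)) (hr a₃) using 1
      funext x
      simp [g, ReLU_sub_ReLU_neg, ramp, add_sub_assoc]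

/-- Each block takes three layers: one for the jump of the count and of the code, and one for each
of the two flanks of the window. -/
theorem computes_blockData (hW : 11 ≤ W) (n : ℕ) (c : ℕ → ℝ) {τ : (Fin d → ℝ) → ℝ}
    (hs : Computes W d L {τ}) (hτ : ∀ x, 0 ≤ τ x) (J : ℕ) :
    Computes W d (L + 3 * J) {τ, fun x => blockCount n J (τ x),
      fun x => blockCode n c J (τ x), fun x => window n J (τ x)} := by
  induction J with
  | zero =>
    refine hs.mono ?_
    rintro _ (rfl | rfl | rfl | rfl)
    · exact mem_affineCombos rfl
    · convert Submodule.zero_mem (affineCombos _) using 1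
      funext x
      simp [blockCount]
    · convert Submodule.smul_mem _ (c 0) (affineCombos_one _) using 1
      funext x
      simp [blockCode]
    · convert Submodule.zero_mem (affineCombos _) using 1
      funext x
      simp [window]
  | succ J ih =>
    have h1 := ih.add_ramp hW hτ 2 (-2 * ((J + 1) * n) + 1) 1 (c (J + 1) - c J) 0
    have h2 := h1.add_ramp hW hτ 1 (-(J * n)) 0 0 1
    have h3 := h2.add_ramp hW hτ 2 (-2 * ((J + 1) * n) + 2) 0 0 (-1)
    refine Eq.subst (motive := fun s => Computes W d (L + 3 * (J + 1)) s) ?_ h3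
    have e1 (T : ℝ) : 2 * T + (-2 * ((J + 1) * n) + 1) = 2 * (T - (J + 1) * n) + 1 := by ring
    have e2 (T : ℝ) : 1 * T + -(J * n) = T - J * n := by ring
    have e3 (T : ℝ) : 2 * T + (-2 * ((J + 1) * n) + 2) = 2 * (T - (J + 1) * n + 1) := by ring
    simp only [blockCount, blockCode, window, Finset.sum_range_succ, e1, e2, e3]
    congr 4 <;> funext x <;> ring

theorem computes_digits (hW : 11 ≤ W) {u c h : (Fin d → ℝ) → ℝ}
    (hs : Computes W d L {u, c, h}) (hu : ∀ x, 0 ≤ u x) (hc : ∀ x, 0 ≤ c x) (hh : ∀ x, 0 ≤ h x)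
    (K : ℕ) :
    Computes W d (L + 2 * K)
      {u, fun x => remainder (c x) K, fun x => digitSum (c x) (u x) K, h} := by
  induction K with
  | zero =>
    refine hs.mono ?_
    rintro _ (rfl | rfl | rfl | rfl)
    · exact mem_affineCombos (by simp)
    · exact mem_affineCombos (by simp [remainder])
    · convert Submodule.zero_mem (affineCombos _) using 1
      funext x
      simp [digitSum]
    · exact mem_affineCombos (by simp)
  | succ K ih =>
    set r : (Fin d → ℝ) → ℝ := fun x => remainder (c x) K
    set D : (Fin d → ℝ) → ℝ := fun x => digitSum (c x) (u x) K
    have hr0 (x) : 0 ≤ r x := by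
      cases K with
      | zero => exact hc x
      | succ K => exact ReLU_nonneg _
    have hD0 (x) : 0 ≤ D x := Finset.sum_nonneg fun _ _ => ReLU_nonneg _
    -- the first layer computes the digit and the part of `[K, K + 1]` to the left of `u`
    have h1 : Computes W d (L + 2 * K + 1) {u, r, D, h, fun x => ramp (6 * r x - 1),
        fun x => ramp (u x - K)} := by
      have m1 := mem_affineCombos (s := {u, r, D, h}) (f := u) (by simp)
      have m2 := mem_affineCombos (s := {u, r, D, h}) (f := r) (by simp)
      have m3 := mem_affineCombos (s := {u, r, D, h}) (f := D) (by simp)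
      have m4 := mem_affineCombos (s := {u, r, D, h}) (f := h) (by simp)
      have mo (a : ℝ) := Submodule.smul_mem _ a (affineCombos_one {u, r, D, h})
      have m6 := Submodule.smul_mem _ (6 : ℝ) m2
      let g : Fin 8 → (Fin d → ℝ) → ℝ :=
        ![u, r, D, h, (6 : ℝ) • r - (1 : ℝ) • 1, (6 : ℝ) • r - (2 : ℝ) • 1, u - (K : ℝ) • 1,
          u - (K + 1 : ℝ) • 1]
      refine (ih.layer (by omega) g ?_).mono ?_
      · intro i
        fin_cases i
        exacts [m1, m2, m3, m4, sub_mem m6 (mo 1), sub_mem m6 (mo 2), sub_mem m1 (mo _),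
          sub_mem m1 (mo _)]
      · rintro _ (rfl | rfl | rfl | rfl | rfl | rfl)
        · convert node_mem g 0 using 1
          funext x
          simp [g, ReLU_of_nonneg (hu x)]
        · convert node_mem g 1 using 1
          funext x
          simp [g, ReLU_of_nonneg (hr0 x)]
        · convert node_mem g 2 using 1
          funext x
          simp [g, ReLU_of_nonneg (hD0 x)]
        · convert node_mem g 3 using 1
          funext x
          simp [g, ReLU_of_nonneg (hh x)]
        · convert sub_mem (node_mem g 4) (node_mem g 5) using 1
          funext x
          have : 6 * r x - 1 - 1 = 6 * r x - 2 := by ring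
          simp [g, ramp, this]
        · convert sub_mem (node_mem g 6) (node_mem g 7) using 1
          funext x
          simp [g, ramp, sub_sub]
    set b : (Fin d → ℝ) → ℝ := fun x => ramp (6 * r x - 1)
    set w : (Fin d → ℝ) → ℝ := fun x => ramp (u x - K)
    have m1 := mem_affineCombos (s := {u, r, D, h, b, w}) (f := u) (by simp)
    have m2 := mem_affineCombos (s := {u, r, D, h, b, w}) (f := r) (by simp)
    have m3 := mem_affineCombos (s := {u, r, D, h, b, w}) (f := D) (by simp)
    have m4 := mem_affineCombos (s := {u, r, D, h, b, w}) (f := h) (by simp)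
    have m5 := mem_affineCombos (s := {u, r, D, h, b, w}) (f := b) (by simp)
    have m6 := mem_affineCombos (s := {u, r, D, h, b, w}) (f := w) (by simp)
    let g : Fin 5 → (Fin d → ℝ) → ℝ := ![u, (3 : ℝ) • r - b, D, h, w + b - 1]
    refine (h1.layer (by omega) g ?_).mono ?_
    · intro i
      fin_cases i
      exacts [m1, sub_mem (Submodule.smul_mem _ _ m2) m5, m3, m4,
        sub_mem (add_mem m6 m5) (affineCombos_one _)]
    · rintro _ (rfl | rfl | rfl | rfl)
      · convert node_mem g 0 using 1
        funext x
        simp [g, ReLU_of_nonneg (hu x)]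
      · exact node_mem g 1
      · convert add_mem (node_mem g 2) (node_mem g 4) using 1
        funext x
        have hx : digitSum (c x) (u x) (K + 1) = D x + ReLU (w x + b x - 1) :=
          Finset.sum_range_succ _ _
        simp [g, ReLU_of_nonneg (hD0 x), hx]
      · convert node_mem g 3 using 1
        funext x
        simp [g, ReLU_of_nonneg (hh x)]

/-- The layers are one for the input, three per block for the block data, one to make these
nonnegative, two per digit, and one for the truncation. -/
theorem computes_bitExtraction (hW : 11 ≤ W) (i₀ : Fin d) (n : ℕ) (c : ℕ → ℝ) :
    Computes W d (5 * n + 3) {fun x => bitExtraction n c (ReLU ((n : ℝ) ^ 2 * x i₀))} := by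
  set τ : (Fin d → ℝ) → ℝ := fun x => ReLU ((n : ℝ) ^ 2 * x i₀) with hτ
  have hA := computes_blockData hW n c (computes_first (by omega) i₀ ((n : ℝ) ^ 2))
    (fun x => ReLU_nonneg _) n
  rw [← hτ] at hA
  set A : (Fin d → ℝ) → ℝ := fun x => blockCount n n (τ x)
  set C : (Fin d → ℝ) → ℝ := fun x => blockCode n c n (τ x)
  set H : (Fin d → ℝ) → ℝ := fun x => window n n (τ x)
  have hB : Computes W d (1 + 3 * n + 1)
      {fun x => ReLU (τ x - n * A x), fun x => ReLU (C x), fun x => ReLU (n * H x)} := by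
    have m1 := mem_affineCombos (s := {τ, A, C, H}) (f := τ) (by simp)
    have m2 := mem_affineCombos (s := {τ, A, C, H}) (f := A) (by simp)
    have m3 := mem_affineCombos (s := {τ, A, C, H}) (f := C) (by simp)
    have m4 := mem_affineCombos (s := {τ, A, C, H}) (f := H) (by simp)
    let g : Fin 3 → (Fin d → ℝ) → ℝ := ![τ - (n : ℝ) • A, C, (n : ℝ) • H]
    refine (hA.layer (by omega) g ?_).mono ?_
    · intro i
      fin_cases i
      exacts [sub_mem m1 (Submodule.smul_mem _ _ m2), m3, Submodule.smul_mem _ _ m4]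
    · rintro _ (rfl | rfl | rfl)
      exacts [node_mem g 0, node_mem g 1, node_mem g 2]
  have hC := computes_digits hW hB (fun x => ReLU_nonneg _) (fun x => ReLU_nonneg _)
    (fun x => ReLU_nonneg _) n
  set u : (Fin d → ℝ) → ℝ := fun x => ReLU (τ x - n * A x)
  set h : (Fin d → ℝ) → ℝ := fun x => ReLU (n * H x)
  set R : (Fin d → ℝ) → ℝ := fun x => remainder (ReLU (C x)) n
  set D : (Fin d → ℝ) → ℝ := fun x => digitSum (ReLU (C x)) (u x) n
  have m1 := mem_affineCombos (s := {u, R, D, h}) (f := u) (by simp)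
  have m3 := mem_affineCombos (s := {u, R, D, h}) (f := D) (by simp)
  have m4 := mem_affineCombos (s := {u, R, D, h}) (f := h) (by simp)
  have ms := sub_mem (Submodule.smul_mem _ (2 : ℝ) m3) m1
  let g : Fin 3 → (Fin d → ℝ) → ℝ := ![(2 : ℝ) • D - u + h, (2 : ℝ) • D - u - h, h]
  rw [show 5 * n + 3 = 1 + 3 * n + 1 + 2 * n + 1 by ring]
  refine (hC.layer (by omega) g ?_).mono ?_
  · intro i
    fin_cases i
    exacts [add_mem ms m4, sub_mem ms m4, m4]
  · rintro _ rfl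
    convert sub_mem (sub_mem (node_mem g 0) (node_mem g 1)) (node_mem g 2) using 1
    funext x
    have hx : ReLU (h x) = h x := ReLU_of_nonneg (ReLU_nonneg _)
    simp only [g, Pi.sub_apply, Matrix.cons_val, hx]
    rfl

end Network

/-! ### Values of the interpolating function -/

/-- The number with the ternary digits `b 0, …, b (m - 1)` after the point. For digits in `{0, 1}`
the codes with first digit `0` and those with first digit `1` are a fixed distance apart, so that
one ramp extracts the digit. -/
noncomputable def ternaryCode : ℕ → (ℕ → ℝ) → ℝ
  | 0, _ => 0
  | m + 1, b => (b 0 + ternaryCode m fun i => b (i + 1)) / 3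

theorem ternaryCode_mem (m : ℕ) (b : ℕ → ℝ) (hb : ∀ i < m, b i = 0 ∨ b i = 1) :
    0 ≤ ternaryCode m b ∧ ternaryCode m b ≤ 1 / 2 := by
  induction m generalizing b with
  | zero => norm_num [ternaryCode]
  | succ m ih =>
    obtain ⟨h0, h1⟩ := ih (fun i => b (i + 1)) fun i hi => hb (i + 1) (by omega)
    rw [ternaryCode]
    rcases hb 0 (by omega) with h | h <;> rw [h] <;> constructor <;> linarith

theorem ramp_ternaryCode (m : ℕ) (b : ℕ → ℝ) (hb : ∀ i < m + 1, b i = 0 ∨ b i = 1) :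
    ramp (6 * ternaryCode (m + 1) b - 1) = b 0 := by
  obtain ⟨h0, h1⟩ := ternaryCode_mem m (fun i => b (i + 1)) fun i hi => hb (i + 1) (by omega)
  rw [ternaryCode]
  rcases hb 0 (by omega) with h | h <;> rw [h]
  · exact ramp_of_nonpos (by linarith)
  · exact ramp_of_one_le (by linarith)

theorem remainder_ternaryCode (k m : ℕ) (b : ℕ → ℝ) (hb : ∀ i < m + k, b i = 0 ∨ b i = 1) :
    remainder (ternaryCode (m + k) b) k = ternaryCode m fun i => b (i + k) := by
  induction k generalizing m with
  | zero => rfl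
  | succ k ih =>
    have hb' : ∀ i < m + 1, b (i + k) = 0 ∨ b (i + k) = 1 := fun i hi => hb _ (by omega)
    rw [remainder, show m + (k + 1) = m + 1 + k by ring, ih (m + 1) fun i hi => hb i (by omega),
      ramp_ternaryCode m _ hb']
    have h0 := (ternaryCode_mem m (fun i => b (i + 1 + k)) fun i hi => hb _ (by omega)).1
    rw [ternaryCode, show ∀ x y : ℝ, 3 * ((x + y) / 3) - x = y by intros; ring, ReLU_of_nonneg h0]
    simp only [add_assoc, add_comm 1 k]

theorem digitSum_ternaryCode {n k : ℕ} (hk : k < n) (b : ℕ → ℝ)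
    (hb : ∀ i < n, b i = 0 ∨ b i = 1) {u : ℝ} (h0 : k ≤ u) (h1 : u ≤ k + 1) :
    digitSum (ternaryCode n b) u n = ∑ i ∈ Finset.range k, b i + b k * (u - k) := by
  have hdigit : ∀ i < n, ramp (6 * remainder (ternaryCode n b) i - 1) = b i := by
    intro i hi
    obtain ⟨m, rfl⟩ : ∃ m, n = m + 1 + i := ⟨n - i - 1, by omega⟩
    rw [remainder_ternaryCode i (m + 1) b hb, ramp_ternaryCode m _ fun l hl => hb _ (by omega),
      zero_add]
  have hdigit0 : ∀ i < n, 0 ≤ b i ∧ b i ≤ 1 := by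
    intro i hi
    rcases hb i hi with h | h <;> norm_num [h]
  rw [digitSum, ← Finset.sum_subset (Finset.range_mono (Nat.succ_le_of_lt hk)),
    Finset.sum_range_succ]
  · congr 1
    · refine Finset.sum_congr rfl fun i hi => ?_
      have hik : (i : ℝ) + 1 ≤ k := by exact_mod_cast Finset.mem_range.1 hi
      have hin : i < n := (Finset.mem_range.1 hi).trans hk
      rw [hdigit i hin, ramp_of_one_le (by linarith), add_sub_cancel_left,
        ReLU_of_nonneg (hdigit0 i hin).1]
    · rw [hdigit k hk, ramp_of_mem (by linarith) (by linarith)]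
      rcases hb k hk with h | h <;> rw [h]
      · rw [ReLU_of_nonpos (by linarith), zero_mul]
      · rw [ReLU_of_nonneg (by linarith)]; ring
  · intro i hi hik
    have hki : (k : ℝ) + 1 ≤ i := by
      have : k < i := by simpa using hik
      exact_mod_cast this
    have hin := Finset.mem_range.1 hi
    rw [hdigit i hin, ramp_of_nonpos (by linarith), ReLU_of_nonpos (by linarith [hdigit0 i hin])]

/-- Off the intervals where they are spread, exactly the jumps of the earlier blocks count. -/
theorem sum_mul_jump {n j : ℕ} (hj : j < n) {T : ℝ} (h0 : (j : ℝ) * n ≤ T)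
    (h1 : T ≤ (j + 1) * n - 1 / 2) (a : ℕ → ℝ) :
    ∑ m ∈ Finset.range n, a m * ramp (2 * (T - (m + 1) * n) + 1) = ∑ m ∈ Finset.range j, a m := by
  have hn : (0 : ℝ) ≤ n := Nat.cast_nonneg n
  rw [← Finset.sum_subset (Finset.range_mono hj.le)]
  · refine Finset.sum_congr rfl fun m hm => ?_
    have hmj : (m : ℝ) + 1 ≤ j := by exact_mod_cast Finset.mem_range.1 hm
    have := mul_le_mul_of_nonneg_right hmj hn
    rw [ramp_of_one_le (by linarith), mul_one]
  · intro m _ hm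
    have hmj : (j : ℝ) ≤ m := by exact_mod_cast (by simpa using hm : j ≤ m)
    have := mul_le_mul_of_nonneg_right hmj hn
    rw [ramp_of_nonpos (by linarith), mul_zero]

theorem window_eq {n j : ℕ} (hj : j < n) {T : ℝ} (h0 : (j : ℝ) * n ≤ T)
    (h1 : T ≤ (j + 1) * n) :
    window n n T = ramp (T - j * n) - ramp (2 * (T - (j + 1) * n + 1)) := by
  have hn : (1 : ℝ) ≤ n := by exact_mod_cast (by omega : 1 ≤ n)
  refine Finset.sum_eq_single j (fun m _ hm => ?_) (fun h => absurd (Finset.mem_range.2 hj) h)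
  rcases lt_or_gt_of_ne hm with hm | hm
  · have hmj : (m : ℝ) + 1 ≤ j := by exact_mod_cast hm
    have := mul_le_mul_of_nonneg_right hmj (zero_le_one.trans hn)
    rw [ramp_of_one_le (by linarith), ramp_of_one_le (by linarith), sub_self]
  · have hmj : (j : ℝ) + 1 ≤ m := by exact_mod_cast hm
    have := mul_le_mul_of_nonneg_right hmj (zero_le_one.trans hn)
    rw [ramp_of_nonpos (by linarith), ramp_of_nonpos (by linarith), sub_self]

/-- The `i`-th digit of the code of the `j`-th block: `1` for a step up of `y`, `0` for a step down. -/
noncomputable def stepDigit (n : ℕ) (y : ℕ → ℝ) (j i : ℕ) : ℝ :=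
  (y (j * n + i + 1) - y (j * n + i) + 1) / 2

/-- The function `bitExtraction` for the codes of the steps of `y`. -/
noncomputable def walkInterpolant (n : ℕ) (y : ℕ → ℝ) : ℝ → ℝ :=
  bitExtraction n fun j => ternaryCode n (stepDigit n y j)

section Values

variable {n : ℕ} {y : ℕ → ℝ}

theorem index_lt_sq {j k : ℕ} (hj : j < n) (hk : k < n) : j * n + k < n ^ 2 := by nlinarith

theorem stepDigit_mem (hy : ∀ i < n ^ 2, y (i + 1) - y i = -1 ∨ y (i + 1) - y i = 1) {j : ℕ}
    (hj : j < n) (i : ℕ) (hi : i < n) : stepDigit n y j i = 0 ∨ stepDigit n y j i = 1 := by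
  rcases hy _ (index_lt_sq hj hi) with h | h <;> norm_num [stepDigit, h]

theorem abs_walk_le (hy0 : ∀ j ≤ n, y (j * n) = 0)
    (hy : ∀ i < n ^ 2, y (i + 1) - y i = -1 ∨ y (i + 1) - y i = 1) {j : ℕ} (hj : j < n) (k : ℕ)
    (hk : k ≤ n) : |y (j * n + k)| ≤ k := by
  induction k with
  | zero => simp [hy0 j hj.le]
  | succ k ih =>
    have h := abs_le.1 (ih (by omega))
    push_cast
    rw [← add_assoc, abs_le]
    rcases hy _ (index_lt_sq hj hk) with h' | h' <;> constructor <;> linarith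

/-- For `0 ≤ h`, the expression on the left is the truncation of `s` to `[-h, h]`. -/
theorem truncation_of_abs_le {s h : ℝ} (hs : |s| ≤ h) : ReLU (s + h) - ReLU (s - h) - h = s := by
  have := abs_le.1 hs
  rw [ReLU_of_nonneg (by linarith), ReLU_of_nonpos (by linarith)]; ring

theorem truncation_mem_of_nonneg {s h : ℝ} (hs : 0 ≤ s) (hh : 0 ≤ h) :
    0 ≤ ReLU (s + h) - ReLU (s - h) - h ∧ ReLU (s + h) - ReLU (s - h) - h ≤ s := by
  rw [ReLU_of_nonneg (by linarith : 0 ≤ s + h)]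
  rcases le_total s h with h' | h'
  · rw [ReLU_of_nonpos (by linarith)]; constructor <;> linarith
  · rw [ReLU_of_nonneg (by linarith)]; constructor <;> linarith

theorem truncation_mem_of_nonpos {s h : ℝ} (hs : s ≤ 0) (hh : 0 ≤ h) :
    s ≤ ReLU (s + h) - ReLU (s - h) - h ∧ ReLU (s + h) - ReLU (s - h) - h ≤ 0 := by
  rw [ReLU_of_nonpos (by linarith : s - h ≤ 0)]
  rcases le_total (-h) s with h' | h'
  · rw [ReLU_of_nonneg (by linarith)]; constructor <;> linarith
  · rw [ReLU_of_nonpos (by linarith)]; constructor <;> linarith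

theorem walkInterpolant_of_window_eq_zero {T : ℝ} (h : window n n T = 0) :
    walkInterpolant n y T = 0 := by
  have h0 : ReLU (n * window n n T) = 0 := by rw [h, mul_zero, ReLU_of_nonneg le_rfl]
  simp only [walkInterpolant, bitExtraction, h0, add_zero, sub_zero, sub_self]

/-- Away from the jumps of the code, the interpolant is the truncation of the piecewise linear
interpolation of the walk. -/
theorem walkInterpolant_eq_truncation (hy0 : ∀ j ≤ n, y (j * n) = 0)
    (hy : ∀ i < n ^ 2, y (i + 1) - y i = -1 ∨ y (i + 1) - y i = 1) {j k : ℕ} (hj : j < n)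
    (hk : k < n) {v : ℝ} (h0 : 0 ≤ v) (h1 : v ≤ 1) (hv : k + v ≤ n - 1 / 2) :
    walkInterpolant n y (j * n + k + v) =
      let s := y (j * n + k) + (y (j * n + k + 1) - y (j * n + k)) * v
      let h := ReLU (n * window n n (j * n + k + v))
      ReLU (s + h) - ReLU (s - h) - h := by
  have hk0 : (0 : ℝ) ≤ k := Nat.cast_nonneg k
  have hT0 : (j : ℝ) * n ≤ j * n + k + v := by linarith
  have hT1 : (j : ℝ) * n + k + v ≤ (j + 1) * n - 1 / 2 := by linarith
  have hcount : blockCount n n (j * n + k + v) = j := by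
    simpa [blockCount] using sum_mul_jump hj hT0 hT1 fun _ => 1
  have hpos : blockPos n (j * n + k + v) = k + v := by
    rw [blockPos, hcount, show (j : ℝ) * n + k + v - n * j = k + v by ring,
      ReLU_of_nonneg (by linarith)]
  have hd := stepDigit_mem hy hj
  have hcode : ReLU (blockCode n (fun j => ternaryCode n (stepDigit n y j)) n (j * n + k + v)) =
      ternaryCode n (stepDigit n y j) := by
    rw [blockCode, sum_mul_jump hj hT0 hT1,
      Finset.sum_range_sub (fun j => ternaryCode n (stepDigit n y j)), add_sub_cancel,
      ReLU_of_nonneg (ternaryCode_mem n _ hd).1]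
  have hsum : 2 * digitSum (ternaryCode n (stepDigit n y j)) (k + v) n - (k + v) =
      y (j * n + k) + (y (j * n + k + 1) - y (j * n + k)) * v := by
    have htel : ∑ i ∈ Finset.range k, stepDigit n y j i = (y (j * n + k) + k) / 2 := by
      have := Finset.sum_range_sub (fun i => y (j * n + i)) k
      simp only [add_zero, hy0 j hj.le, sub_zero, ← add_assoc] at this
      simp only [stepDigit, ← Finset.sum_div, Finset.sum_add_distrib, this]
      simp
    rw [digitSum_ternaryCode hk _ hd (by linarith) (by linarith), htel, stepDigit]
    ring
  simp only [walkInterpolant, bitExtraction, hpos, hcode, hsum]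

/-- On the `k`-th unit of the `j`-th block, the interpolant starts from the value of the walk and
stays within distance `1` of it. -/
theorem walkInterpolant_spec (hn : 4 ≤ n) (hy0 : ∀ j ≤ n, y (j * n) = 0)
    (hy : ∀ i < n ^ 2, y (i + 1) - y i = -1 ∨ y (i + 1) - y i = 1) {j k : ℕ} (hj : j < n)
    (hk : k < n) {v : ℝ} (h0 : 0 ≤ v) (h1 : v ≤ 1) :
    (v = 0 → walkInterpolant n y (j * n + k + v) = y (j * n + k)) ∧
      |walkInterpolant n y (j * n + k + v) - y (j * n + k)| ≤ 1 := by
  have hn' : (4 : ℝ) ≤ n := by exact_mod_cast hn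
  have hk' : (k : ℝ) + 1 ≤ n := by exact_mod_cast hk
  have hk0 : (0 : ℝ) ≤ k := Nat.cast_nonneg k
  have hstep := hy _ (index_lt_sq hj hk)
  have hwin := window_eq hj (T := j * n + k + v) (by linarith) (by linarith)
  rw [show (j : ℝ) * n + k + v - j * n = k + v by ring,
    show (j : ℝ) * n + k + v - (j + 1) * n + 1 = k + 1 - n + v by ring] at hwin
  have hexact : k + v ≤ n - 1 / 2 →
      |y (j * n + k) + (y (j * n + k + 1) - y (j * n + k)) * v| ≤
        ReLU (n * window n n (j * n + k + v)) →
      (v = 0 → walkInterpolant n y (j * n + k + v) = y (j * n + k)) ∧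
        |walkInterpolant n y (j * n + k + v) - y (j * n + k)| ≤ 1 := by
    intro hv hle
    rw [walkInterpolant_eq_truncation hy0 hy hj hk h0 h1 hv]
    dsimp only
    rw [truncation_of_abs_le hle]
    refine ⟨fun h => by rw [h]; ring, ?_⟩
    rw [add_sub_cancel_left, abs_le]
    rcases hstep with h | h <;> rw [h] <;> constructor <;> linarith
  have hwalk := abs_le.1 (abs_walk_le hy0 hy hj k hk.le)
  -- the linear interpolation is bounded by the distance `k + v` to the left end of the block
  have hs : |y (j * n + k) + (y (j * n + k + 1) - y (j * n + k)) * v| ≤ k + v := by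
    rw [abs_le]
    rcases hstep with h | h <;> rw [h] <;> constructor <;> linarith
  rcases Nat.lt_or_ge (k + 1) n with hkn | hkn
  · -- before the last unit, the window is wide enough for the truncation to have no effect
    have hkn' : (k : ℝ) + 2 ≤ n := by exact_mod_cast hkn
    rw [ramp_of_nonpos (by linarith : 2 * ((k : ℝ) + 1 - n + v) ≤ 0), sub_zero] at hwin
    refine hexact (by linarith) (hs.trans ?_)
    rw [hwin, ReLU_of_nonneg (mul_nonneg (by linarith) (ramp_nonneg _))]
    rcases le_total ((k : ℝ) + v) 1 with h | h
    · rw [ramp_of_mem (by linarith) h]; nlinarith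
    · rw [ramp_of_one_le h]; linarith
  · have hnk : n = k + 1 := by omega
    have hnk' : (n : ℝ) = k + 1 := by exact_mod_cast hnk
    rw [show 2 * ((k : ℝ) + 1 - n + v) = 2 * v by rw [hnk']; ring,
      ramp_of_one_le (by linarith)] at hwin
    have hend : y (j * n + k + 1) = 0 := by
      rw [show j * n + k + 1 = (j + 1) * n by rw [add_mul]; omega]
      exact hy0 (j + 1) hj
    rcases h0.eq_or_lt with rfl | hv0
    · refine hexact (by linarith) (hs.trans ?_)
      rw [hwin, ramp_of_nonpos (by linarith), ReLU_of_nonneg (by linarith)]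
      linarith
    · refine ⟨fun h => absurd h hv0.ne', ?_⟩
      rcases le_total v (1 / 2) with hv | hv
      · -- truncation moves the value towards `0`, not past it
        rw [walkInterpolant_eq_truncation hy0 hy hj hk h0 h1 (by linarith)]
        dsimp only
        rw [hend] at hstep ⊢
        rw [abs_le]
        have hh := ReLU_nonneg (n * window n n (j * n + k + v))
        rcases hstep with h | h
        · have := truncation_mem_of_nonneg (by nlinarith :
            0 ≤ y (j * n + k) + (0 - y (j * n + k)) * v) hh
          constructor <;> nlinarith
        · have := truncation_mem_of_nonpos (by nlinarith :
            y (j * n + k) + (0 - y (j * n + k)) * v ≤ 0) hh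
          constructor <;> nlinarith
      · rw [ramp_of_one_le (by linarith), sub_self] at hwin
        rw [walkInterpolant_of_window_eq_zero hwin, abs_le]
        rw [hend] at hstep
        rcases hstep with h | h <;> constructor <;> linarith

theorem walkInterpolant_sq (hn : 4 ≤ n) : walkInterpolant n y ((n : ℝ) ^ 2) = 0 := by
  have hn' : (4 : ℝ) ≤ n := by exact_mod_cast hn
  apply walkInterpolant_of_window_eq_zero
  have hc : ((n - 1 : ℕ) : ℝ) = n - 1 := by rw [Nat.cast_sub (by omega)]; simp
  rw [window_eq (j := n - 1) (by omega) (by rw [hc]; nlinarith) (by rw [hc]; nlinarith), hc,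
    ramp_of_one_le (by nlinarith), ramp_of_one_le (by nlinarith), sub_self]

end Values

/-! ### Interpolation and shattering -/

/-- Bit extraction for any width from `11` on, any depth from `5 * n + 3` on, and inputs of any
dimension, of which only the coordinate `i₀` is used. -/
theorem exists_walk_interpolation {W L d n : ℕ} (hW : 11 ≤ W) (hn : 4 ≤ n) (hL : 5 * n + 3 ≤ L)
    (i₀ : Fin d) {y : ℕ → ℝ} (hy0 : ∀ j ≤ n, y (j * n) = 0)
    (hy : ∀ i < n ^ 2, y (i + 1) - y i = -1 ∨ y (i + 1) - y i = 1) :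
    ∃ S ∈ Upsilon W L ReLU d 1,
      (∀ i ≤ n ^ 2, ∀ x, x i₀ = (i : ℝ) / (n : ℝ) ^ 2 → S x 0 = y i) ∧
      ∀ i < n ^ 2, ∀ x, x i₀ ∈ Set.Icc ((i : ℝ) / (n : ℝ) ^ 2) (((i : ℝ) + 1) / (n : ℝ) ^ 2) →
        |S x 0 - y i| ≤ 1 := by
  have hn2 : (0 : ℝ) < (n : ℝ) ^ 2 := by positivity
  obtain ⟨S, hS, hSx⟩ := ((computes_bitExtraction hW i₀ n fun j =>
    ternaryCode n (stepDigit n y j)).pad (by omega) hL).exists_mem_Upsilon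
  have hspec : ∀ i < n ^ 2, ∀ v : ℝ, 0 ≤ v → v ≤ 1 →
      (v = 0 → walkInterpolant n y (i + v) = y i) ∧ |walkInterpolant n y (i + v) - y i| ≤ 1 := by
    intro i hi v h0 h1
    have hj : i / n < n := Nat.div_lt_of_lt_mul (by rwa [← sq])
    have := walkInterpolant_spec hn hy0 hy hj (Nat.mod_lt i (by omega)) h0 h1
    have hi' : i / n * n + i % n = i := Nat.div_add_mod' i n
    have hic : ((i / n : ℕ) : ℝ) * n + (i % n : ℕ) = i := by exact_mod_cast hi'
    rwa [hic, hi'] at this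
  refine ⟨S, hS, fun i hi x hx => ?_, fun i hi x hx => ?_⟩
  · rw [hSx, hx, mul_div_cancel₀ _ hn2.ne', ReLU_of_nonneg (Nat.cast_nonneg i)]
    rcases hi.lt_or_eq with hi | rfl
    · simpa [walkInterpolant] using (hspec i hi 0 le_rfl zero_le_one).1 rfl
    · have := walkInterpolant_sq (y := y) hn
      rw [sq, hy0 n le_rfl]
      simpa [walkInterpolant, sq] using this
  · have h0 := (div_le_iff₀' hn2).1 hx.1
    have h1 := (le_div_iff₀' hn2).1 hx.2
    have := (hspec i hi ((n : ℝ) ^ 2 * x i₀ - i) (by linarith) (by linarith)).2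
    rw [add_sub_cancel] at this
    rwa [hSx, ReLU_of_nonneg ((Nat.cast_nonneg i).trans h0)]

theorem card_le_vcDimension {X : Type*} {Ω : Set X} {F : Set (X → ℝ)} {P : Finset X}
    (hP : (P : Set X) ⊆ Ω) (hF : ShatteredBy F P) : (P.card : ℕ∞) ≤ vcDimension Ω F :=
  le_iSup₂_of_le P ⟨hP, hF⟩ le_rfl

theorem const_mem_scalarUpsilon (W L d : ℕ) (a : ℝ) :
    (fun _ => a) ∈ scalarUpsilon W L ReLU d := by
  suffices h : (fun _ _ => a) ∈ Upsilon W L ReLU d 1 from ⟨_, h, rfl⟩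
  induction L generalizing d with
  | zero => exact ⟨.output 0 fun _ => a, by funext x i; simp [FCNet.eval]⟩
  | succ L ih =>
    obtain ⟨N, hN⟩ := ih W
    refine ⟨.layer 0 0 N, ?_⟩
    funext x
    exact congrFun hN _

theorem one_le_vcDimension (W L d : ℕ) :
    1 ≤ vcDimension (Set.Icc 0 1) (scalarUpsilon W L ReLU d) := by
  refine le_of_eq_of_le (by simp) (card_le_vcDimension (P := {0}) (by simp) ?_)
  intro Λ _
  by_cases h : (0 : Fin d → ℝ) ∈ Λ
  · exact ⟨_, const_mem_scalarUpsilon W L d 1, by simp [h]⟩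
  · exact ⟨_, const_mem_scalarUpsilon W L d 0, by simp [h]⟩

/-- The points of the grid with odd index are shattered: a walk that vanishes at the even indices
has an arbitrary sign at each odd index. -/
theorem two_mul_sq_le_vcDimension {W L d m : ℕ} (hW : 11 ≤ W) (hm : 2 ≤ m) (hL : 10 * m + 3 ≤ L)
    (hd : 1 ≤ d) :
    ((2 * m ^ 2 : ℕ) : ℕ∞) ≤ vcDimension (Set.Icc 0 1) (scalarUpsilon W L ReLU d) := by
  classical
  have hn2 : (0 : ℝ) < ((2 * m : ℕ) : ℝ) ^ 2 := by positivity
  let pt : ℕ → Fin d → ℝ := fun i _ => (i : ℝ) / ((2 * m : ℕ) : ℝ) ^ 2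
  have hpt : Function.Injective pt := by
    intro i i' h
    have := (div_left_inj' hn2.ne').1 (congrFun h ⟨0, hd⟩)
    exact_mod_cast this
  let P : Finset (Fin d → ℝ) := (Finset.range (2 * m ^ 2)).image fun p => pt (2 * p + 1)
  have hcard : P.card = 2 * m ^ 2 := by
    rw [Finset.card_image_of_injective, Finset.card_range]
    intro p q h
    have := hpt h
    omega
  have hodd : ∀ p < 2 * m ^ 2, 2 * p + 1 ≤ (2 * m) ^ 2 := by
    intro p hp
    rw [mul_pow]
    omega
  rw [← hcard]
  refine card_le_vcDimension ?_ ?_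
  · intro x hx
    obtain ⟨p, hp, rfl⟩ := Finset.mem_image.1 (Finset.mem_coe.1 hx)
    refine ⟨fun _ => div_nonneg (Nat.cast_nonneg _) hn2.le, fun _ => (div_le_one hn2).2 ?_⟩
    exact_mod_cast hodd p (Finset.mem_range.1 hp)
  · intro Λ _
    let y : ℕ → ℝ := fun i => if Even i then 0 else if pt i ∈ Λ then 1 else -1
    obtain ⟨S, hS, hSy, -⟩ := exists_walk_interpolation (n := 2 * m) hW (by omega)
      (by omega : 5 * (2 * m) + 3 ≤ L) ⟨0, hd⟩ (y := y)
      (fun j _ => if_pos (Nat.even_mul.2 (Or.inr (even_two_mul m)))) (by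
        intro i _
        rcases Nat.even_or_odd i with hi | hi
        · have hi' : ¬ Even (i + 1) := by simpa [Nat.even_add_one] using hi
          simp only [y, if_pos hi, if_neg hi', sub_zero]
          split_ifs <;> simp
        · have hi' : Even (i + 1) := hi.add_one
          simp only [y, if_pos hi', if_neg (Nat.not_even_iff_odd.2 hi), zero_sub]
          split_ifs <;> simp)
    refine ⟨_, ⟨S, hS, rfl⟩, ?_⟩
    intro x hx
    obtain ⟨p, hp, rfl⟩ := Finset.mem_image.1 hx
    have hp' : ¬ Even (2 * p + 1) := by simp
    dsimp only
    rw [hSy _ (hodd p (Finset.mem_range.1 hp)) _ rfl]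
    simp only [y, if_neg hp']
    split_ifs with h <;> simp [h]

theorem quadratic_le_vcDimension {W L d : ℕ} (hW : 11 ≤ W) (hd : 1 ≤ d) :
    ENNReal.ofReal (1 / 4000 * (L : ℝ) ^ 2) ≤
      ((vcDimension (Set.Icc 0 1) (scalarUpsilon W L ReLU d) : ℕ∞) : ℝ≥0∞) := by
  obtain ⟨k, hk, hkL⟩ : ∃ k : ℕ, (k : ℕ∞) ≤ vcDimension (Set.Icc 0 1) (scalarUpsilon W L ReLU d) ∧
      1 / 4000 * (L : ℝ) ^ 2 ≤ k := by
    rcases Nat.lt_or_ge L 23 with h | h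
    · refine ⟨1, by exact_mod_cast one_le_vcDimension W L d, ?_⟩
      have : (L : ℝ) ≤ 23 := by exact_mod_cast h.le
      push_cast
      nlinarith [(Nat.cast_nonneg L : (0 : ℝ) ≤ L)]
    · -- the largest even `n = 2 * m` with `5 * n + 3 ≤ L`
      refine ⟨_, two_mul_sq_le_vcDimension (m := (L - 3) / 10) hW (by omega) (by omega) hd, ?_⟩
      have hL : L ≤ 20 * ((L - 3) / 10) := by omega
      have hL' : (L : ℝ) ≤ 20 * ((L - 3) / 10 : ℕ) := by exact_mod_cast hL
      push_cast
      nlinarith [(Nat.cast_nonneg L : (0 : ℝ) ≤ L)]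
  calc ENNReal.ofReal (1 / 4000 * (L : ℝ) ^ 2) ≤ ((k : ℕ∞) : ℝ≥0∞) := by
        rw [ENat.toENNReal_coe]
        exact ENNReal.ofReal_le_of_le_toReal (by simpa using hkL)
    _ ≤ _ := ENat.toENNReal_le.2 hk

theorem theoremT :
    -- interpolation by bit extraction
    (∀ n : ℕ, 4 ≤ n → Even n → ∀ y : ℕ → ℝ,
      (∀ j ≤ n, y (j * n) = 0) →
      (∀ i < n ^ 2, y (i + 1) - y i = -1 ∨ y (i + 1) - y i = 1) →
      ∃ S ∈ Upsilon 11 (15 * n + 2) ReLU 1 1,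
        (∀ i ≤ n ^ 2, S (fun _ => (i : ℝ) / (n : ℝ) ^ 2) 0 = y i) ∧
        ∀ i < n ^ 2, ∀ t ∈ Set.Icc ((i : ℝ) / (n : ℝ) ^ 2) (((i : ℝ) + 1) / (n : ℝ) ^ 2),
          |S (fun _ => t) 0 - S (fun _ => (i : ℝ) / (n : ℝ) ^ 2) 0| ≤ 1) ∧
    -- lower bound for the VC dimension, input dimension one, widths from 11 on
    (∃ c : ℝ, 0 < c ∧ ∀ W L : ℕ, 11 ≤ W → 1 ≤ L →
      ENNReal.ofReal (c * (L : ℝ) ^ 2) ≤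
        ((vcDimension (Set.Icc 0 1) (scalarUpsilon W L ReLU 1) : ℕ∞) : ℝ≥0∞)) ∧
    -- lower bound for the VC dimension, any input dimension, fixed large widths
    (∀ d : ℕ, 1 ≤ d → ∃ W₀ : ℕ, ∃ c : ℝ, 0 < c ∧ ∀ W L : ℕ, W₀ ≤ W → 1 ≤ L →
      ENNReal.ofReal (c * (L : ℝ) ^ 2) ≤
        ((vcDimension (Set.Icc 0 1) (scalarUpsilon W L ReLU d) : ℕ∞) : ℝ≥0∞)) := by
  refine ⟨fun n hn _ y hy0 hy => ?_, ⟨1 / 4000, by norm_num, fun W L hW _ =>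
    quadratic_le_vcDimension hW le_rfl⟩, fun d hd => ⟨11, 1 / 4000, by norm_num, fun W L hW _ =>
    quadratic_le_vcDimension hW hd⟩⟩
  obtain ⟨S, hS, hSy, hSi⟩ := exists_walk_interpolation (W := 11) (L := 15 * n + 2) le_rfl hn
    (by omega) (0 : Fin 1) hy0 hy
  refine ⟨S, hS, fun i hi => hSy i hi _ rfl, fun i hi t ht => ?_⟩
  rw [hSy i hi.le (fun _ => (i : ℝ) / (n : ℝ) ^ 2) rfl]
  exact hSi i hi _ ht
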